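/- Let $G$ be a finite group and $N \trianglelefteq G$ a normal subgroup such that $G/N$ is cyclic, generated by the image of $q \in G$. Write $\operatorname{Irr} G$ for the set of irreducible complex characters of $G$ (and similarly for $N$), and let the character group $\hat Q = \operatorname{Hom}(G/N, \mathbb{C}^\times)$ act on $\operatorname{Irr} G$ by tensoring, $(\chi\cdot\rho)(g) = \chi(gN)\rho(g)$; write $[\rho]$ for the $\hat Q$-orbit of $\rho$. Then the following numbers are equal: - the number of conjugacy classes of $G$ contained in $qN$; - the number of $\hat Q$-orbits $[\rho]$ on $\operatorname{Irr} G$ with $\rho$ not identically $0$ on $qN$; - the number of $\hat Q$-orbits on $\operatorname{Irr} G$ of length $(G:N)$; - $\tfrac{1}{(G:N)}$ times the number of $\rho \in \operatorname{Irr} G$ whose restriction to $N$ is irreducible; - the number of $\tau \in \operatorname{Irr} N$ that extend to a character of $G$. -/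

import Mathlib

open scoped Pointwise

noncomputable section

namespace CosetChar

/-- `IsCharacter G f`: the function `f` is the character of a finite-dimensional complex
representation of `G`. -/
def IsCharacter (G : Type*) [Group G] (f : G → ℂ) : Prop :=
  ∃ (V : Type) (_ : AddCommGroup V) (_ : Module ℂ V) (_ : FiniteDimensional ℂ V)
    (π : Representation ℂ G V), f = π.character

/-- `Irr G`: the set of complex irreducible characters of `G`, i.e. of the characters of
irreducible finite-dimensional complex representations of `G`. -/
def Irr (G : Type*) [Group G] : Set (G → ℂ) :=
  {f | ∃ (V : Type) (_ : AddCommGroup V) (_ : Module ℂ V) (_ : FiniteDimensional ℂ V)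
    (π : Representation ℂ G V), π.IsIrreducible ∧ f = π.character}

/-- The restriction to a subgroup `N` of a function on `G`. -/
def Res {G : Type*} [Group G] (N : Subgroup G) (f : G → ℂ) : N → ℂ := fun n => f n

/-- The tensor product `χ ⊗ π` of a representation `π` with a one-dimensional character `χ`. -/
def twist {G V : Type*} [Group G] [AddCommGroup V] [Module ℂ V]
    (χ : G →* ℂˣ) (π : Representation ℂ G V) : Representation ℂ G V where
  toFun g := (χ g : ℂ) • π g
  map_one' := by simp
  map_mul' g h := by
    ext v
    simp only [map_mul, Units.val_mul, LinearMap.smul_apply, Module.End.mul_apply, map_smul]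
    rw [mul_smul, smul_comm]

theorem twist_character {G V : Type*} [Group G] [AddCommGroup V] [Module ℂ V]
    (χ : G →* ℂˣ) (π : Representation ℂ G V) (g : G) :
    (twist χ π).character g = (χ g : ℂ) * π.character g := by
  change LinearMap.trace ℂ V ((χ g : ℂ) • π g) = _
  rw [map_smul, smul_eq_mul]
  rfl

/-- A representation and its twist have the same invariant subspaces. -/
def twistSubrep {G V : Type*} [Group G] [AddCommGroup V] [Module ℂ V]
    (χ : G →* ℂˣ) (π : Representation ℂ G V) :
    Subrepresentation (twist χ π) ≃o Subrepresentation π where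
  toFun W := ⟨W.toSubmodule, fun g v hv => by
    have h := W.toSubmodule.smul_mem ((χ g)⁻¹ : ℂˣ).1 (W.apply_mem_toSubmodule g hv)
    change ((χ g)⁻¹ : ℂˣ).1 • ((χ g : ℂ) • π g v) ∈ W.toSubmodule at h
    rwa [smul_smul, Units.inv_mul, one_smul] at h⟩
  invFun W := ⟨W.toSubmodule, fun g _ hv =>
    W.toSubmodule.smul_mem _ (W.apply_mem_toSubmodule g hv)⟩
  left_inv _ := rfl
  right_inv _ := rfl
  map_rel_iff' := Iff.rfl

theorem twist_mem_Irr {G : Type*} [Group G] (χ : G →* ℂˣ) {f : G → ℂ} (hf : f ∈ Irr G) :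
    (fun g => (χ g : ℂ) * f g) ∈ Irr G := by
  obtain ⟨V, i1, i2, i3, π, hπ, rfl⟩ := hf
  refine ⟨V, i1, i2, i3, twist χ π, (twistSubrep χ π).isSimpleOrder_iff.mpr hπ, ?_⟩
  funext g
  exact (twist_character χ π g).symm

/-- The character group of `G ⧸ N` acts on `Irr G` by tensoring:
`(χ • ρ) g = χ (gN) * ρ g`. -/
instance irrAction {G : Type*} [Group G] (N : Subgroup G) [N.Normal] :
    MulAction (G ⧸ N →* ℂˣ) (Irr G) where
  smul χ ρ := ⟨fun g => (χ (g : G ⧸ N) : ℂ) * ρ.1 g,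
    twist_mem_Irr (χ.comp (QuotientGroup.mk' N)) ρ.2⟩
  one_smul ρ := Subtype.ext (funext fun g => one_mul (ρ.1 g))
  mul_smul χ ψ ρ := Subtype.ext (funext fun g =>
    mul_assoc (χ (g : G ⧸ N) : ℂ) (ψ (g : G ⧸ N) : ℂ) (ρ.1 g))

/-- The set of orbits of the character group of `G ⧸ N` on `Irr G`. -/
abbrev Orbits {G : Type*} [Group G] (N : Subgroup G) [N.Normal] : Type _ :=
  MulAction.orbitRel.Quotient (G ⧸ N →* ℂˣ) (Irr G)

/-- The orbit `[ρ]` of `ρ` under the character group of `G ⧸ N`. -/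
def orbitOf {G : Type*} [Group G] (N : Subgroup G) [N.Normal] (ρ : Irr G) : Orbits N :=
  Quotient.mk (MulAction.orbitRel (G ⧸ N →* ℂˣ) (Irr G)) ρ

/-- The set of conjugacy classes of `G` that lie inside the coset `qN`. -/
def classesIn {G : Type*} [Group G] (N : Subgroup G) (q : G) : Set (ConjClasses G) :=
  {C | C.carrier ⊆ q • (N : Set G)}

/-- The set of orbits `[ρ]` on `Irr G` with `ρ` not identically `0` on the coset `qN`. -/
def orbitsNonzeroOn {G : Type*} [Group G] (N : Subgroup G) [N.Normal] (q : G) :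
    Set (Orbits N) :=
  {ω | ∃ ρ : Irr G, orbitOf N ρ = ω ∧ ∃ g ∈ q • (N : Set G), ρ.1 g ≠ 0}

/-- The set of orbits on `Irr G` of length `(G : N)`. -/
def orbitsOfFullLength {G : Type*} [Group G] (N : Subgroup G) [N.Normal] : Set (Orbits N) :=
  {ω | ω.orbit.ncard = N.index}

end CosetChar

end

namespace CosetChar

open Representation

/-! Averaging over the character group of `G ⧸ N` isolates a coset `p`: the sum of `χ (p⁻¹ * g)`
over all `χ` is `(G : N)` if `g` lies in `p` and `0` otherwise. Hence the scalar product of `ρ` and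
`ρ'` over `p` is a weighted sum of the global scalar products of `χ • ρ` with `ρ'`
(`index_mul_cosetSum`). It vanishes when `ρ` and `ρ'` lie in different orbits, and equals `|N|` when
`ρ = ρ'` has trivial stabilizer.

Trivial stabilizer is the common meaning of the conditions on `ρ`: full orbit length by
orbit-stabilizer, irreducible restriction by taking `p = 1`, and nonvanishing on `qN` because `q`
generates the quotient. An irreducible restriction determines its orbit, so full orbits correspond
to extendable `τ`.

Finally, `qN` is a union of classes, and representatives of the orbits not vanishing on it restrict
to a basis of the class functions on `qN`: they are independent by coset orthogonality, and there
are enough of them by completeness of the irreducible characters. -/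

theorem character_mem_Irr {G V : Type*} [Group G] [AddCommGroup V] [Module ℂ V]
    [FiniteDimensional ℂ V] (π : Representation ℂ G V) (hπ : π.IsIrreducible) :
    π.character ∈ Irr G := by
  -- `Irr` only admits spaces in `Type`, so a representation on a space in another universe is moved
  -- to coordinates.
  let e : V ≃ₗ[ℂ] (Fin (Module.finrank ℂ V) → ℂ) := (Module.finBasis ℂ V).equivFun
  let σ : Representation ℂ G (Fin (Module.finrank ℂ V) → ℂ) :=
    { toFun := fun g => e.conj (π g)
      map_one' := by simp [Module.End.one_eq_id]
      map_mul' := fun g h => by simp [Module.End.mul_eq_comp, LinearEquiv.conj_comp] }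
  let φ : π.Equiv σ := Representation.Equiv.mk e fun g =>
    LinearMap.ext fun v => by simp [σ, LinearEquiv.conj_apply]
  refine ⟨_, inferInstance, inferInstance, inferInstance, σ, ?_, char_iso φ⟩
  rw [irreducible_iff_isSimpleModule_asModule] at hπ ⊢
  let ψ := IntertwiningMap.equivLinearMapAsModule σ π φ.symm.toIntertwiningMap
  have hψ : Function.Bijective ψ := φ.symm.toLinearEquiv.bijective
  exact IsSimpleModule.congr (LinearEquiv.ofBijective ψ hψ)

/-! ### Orthogonality and completeness of the irreducible characters -/

section Orthogonality

variable {G : Type*} [Group G] [Fintype G]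

theorem sum_mul_inv_eq_ite [DecidableEq (G → ℂ)] {f h : G → ℂ} (hf : f ∈ Irr G) (hh : h ∈ Irr G) :
    ∑ g, f g * h g⁻¹ = if f = h then (Nat.card G : ℂ) else 0 := by
  obtain ⟨V, _, _, _, π, hπ, rfl⟩ := hf
  obtain ⟨W, _, _, _, σ, hσ, rfl⟩ := hh
  have h0 : (Nat.card G : ℂ) ≠ 0 := Nat.cast_ne_zero.mpr Nat.card_pos.ne'
  let _ := invertibleOfNonzero h0
  have key := char_orthonormal π σ
  have key' := char_orthonormal π π
  rw [if_pos ⟨Representation.Equiv.refl π⟩] at key'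
  rw [inv_mul_eq_iff_eq_mul₀ h0] at key key'
  split_ifs with h
  · rw [← h, key', mul_one]
  · rw [key, if_neg, mul_zero]
    rintro ⟨φ⟩
    exact h (char_iso φ).symm

/-- Norm one makes the intertwining algebra one-dimensional. By Maschke a subrepresentation is the
image of an equivariant projection, which is then a scalar. -/
theorem isIrreducible_of_sum_mul_inv_eq_card {V : Type*} [AddCommGroup V] [Module ℂ V]
    [FiniteDimensional ℂ V] (π : Representation ℂ G V)
    (h : ∑ g, π.character g * π.character g⁻¹ = Nat.card G) : π.IsIrreducible := by
  have h0 : (Nat.card G : ℂ) ≠ 0 := Nat.cast_ne_zero.mpr Nat.card_pos.ne'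
  let _ := invertibleOfNonzero h0
  have key := card_inv_mul_sum_char_mul_char_eq_finrank π π
  rw [h, inv_mul_cancel₀ h0] at key
  have hfin : Module.finrank ℂ (IntertwiningMap π π) = 1 := by exact_mod_cast key.symm
  have hne : (1 : IntertwiningMap π π) ≠ 0 := by
    intro h1
    have : Subsingleton (IntertwiningMap π π) :=
      ⟨fun a b => by rw [← mul_one a, ← mul_one b, h1, mul_zero, mul_zero]⟩
    simp [Module.finrank_zero_of_subsingleton] at hfin
  have hscal := (finrank_eq_one_iff_of_nonzero' _ hne).mp hfin
  have hV : Nontrivial V := by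
    by_contra hV
    rw [not_nontrivial_iff_subsingleton] at hV
    exact hne (IntertwiningMap.ext <| LinearMap.ext fun v => Subsingleton.elim _ _)
  rw [irreducible_iff_isSimpleModule_asModule]
  have : NeZero (Nat.card G : ℂ) := ⟨h0⟩
  have hN : Nontrivial π.asModule := hV
  refine isSimpleModule_iff _ _ |>.mpr
    { exists_pair_ne := exists_pair_ne _, eq_bot_or_eq_top := fun W => ?_ }
  obtain ⟨W', hW⟩ := exists_isCompl W
  obtain ⟨c, hc⟩ := hscal ((IntertwiningMap.equivLinearMapAsModule π π).symm (W.subtype ∘ₗ W.projectionOnto W' hW))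
  have hc' : ∀ v : π.asModule, c • v = (W.projectionOnto W' hW v : π.asModule) := fun v =>
    congrArg (fun f : IntertwiningMap π π => f v) hc
  by_cases hc0 : c = 0
  · left
    rw [eq_bot_iff]
    intro w hw
    have := hc' w
    rw [Submodule.projectionOnto_apply_left hW ⟨w, hw⟩, hc0, zero_smul] at this
    exact this.symm
  · right
    rw [eq_top_iff]
    intro v _
    have h1 : c • v ∈ W := hc' v ▸ Subtype.prop _
    simpa [smul_smul, inv_mul_cancel₀ hc0] using W.smul_of_tower_mem c⁻¹ h1

/-- The operator commutes with `π`, so by Schur it is a scalar `c`; its trace `c * dim V` vanishes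
and `V ≠ 0`. -/
theorem sum_smul_eq_zero_of_isIrreducible {V : Type*} [AddCommGroup V] [Module ℂ V]
    [FiniteDimensional ℂ V] (π : Representation ℂ G V) (hπ : π.IsIrreducible) {F : G → ℂ}
    (hF : ∀ g h, F (h * g * h⁻¹) = F g) (h0 : ∑ g, F g * π.character g = 0) :
    ∑ g, F g • π g = 0 := by
  let T : IntertwiningMap π π :=
    { toLinearMap := ∑ g, F g • π g
      isIntertwining' := fun x => by
        change (∑ g, F g • π g) * π x = π x * (∑ g, F g • π g)
        rw [Finset.sum_mul, Finset.mul_sum]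
        refine Fintype.sum_equiv (MulAut.conj x⁻¹).toEquiv _ _ fun g => ?_
        have := hF g x⁻¹
        simp only [MulEquiv.toEquiv_eq_coe, EquivLike.coe_coe, MulAut.conj_apply, this,
          smul_mul_assoc, mul_smul_comm, ← map_mul]
        congr 2
        group }
  obtain ⟨c, hc⟩ := (IsIrreducible.algebraMap_intertwiningMap_bijective_of_isAlgClosed (ρ := π)).2 T
  have hT : ∑ g, F g • π g = c • (1 : Module.End ℂ V) :=
    (congrArg IntertwiningMap.toLinearMap hc).symm
  have htr := congrArg (LinearMap.trace ℂ V) hT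
  simp only [map_sum, map_smul, smul_eq_mul, LinearMap.trace_one] at htr
  have hV : Nontrivial V := by
    by_contra hV
    rw [not_nontrivial_iff_subsingleton] at hV
    obtain ⟨a, b, hab⟩ := hπ.exists_pair_ne
    exact hab (Subrepresentation.toSubmodule_injective (Subsingleton.elim _ _))
  rw [show ∑ g, F g * LinearMap.trace ℂ V (π g) = 0 from h0, eq_comm, mul_eq_zero] at htr
  rw [hT, htr.resolve_right (Nat.cast_ne_zero.mpr Module.finrank_pos.ne'), zero_smul]

/-- The element of the group algebra with coefficients `F` kills every simple module, so it lies in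
the Jacobson radical, which is zero by Maschke. -/
theorem eq_zero_of_sum_mul_Irr_eq_zero {F : G → ℂ} (hF : ∀ g h, F (h * g * h⁻¹) = F g)
    (h0 : ∀ f ∈ Irr G, ∑ g, F g * f g = 0) : F = 0 := by
  have : NeZero (Nat.card G : ℂ) := ⟨Nat.cast_ne_zero.mpr Nat.card_pos.ne'⟩
  let a : MonoidAlgebra ℂ G := ∑ g, MonoidAlgebra.single g (F g)
  have ha : a ∈ Ring.jacobson (MonoidAlgebra ℂ G) := by
    rw [Ring.jacobson_eq_sInf_isMaximal, Submodule.mem_sInf]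
    intro I hI
    let M := MonoidAlgebra ℂ G ⧸ I
    have hM : IsSimpleModule (MonoidAlgebra ℂ G) M :=
      isSimpleModule_iff_isCoatom.mpr (Ideal.isMaximal_def.mp hI)
    let π : Representation ℂ G M := ofModule' M
    have hact (r : MonoidAlgebra ℂ G) (m : M) : π.asAlgebraHom r m = r • m := by
      have : π.asAlgebraHom = Algebra.lsmul ℂ ℂ M :=
        (MonoidAlgebra.lift ℂ (Module.End ℂ M) G).apply_symm_apply _
      rw [this]
      rfl
    have hπ : π.IsIrreducible := by
      rw [irreducible_iff_isSimpleModule_asModule]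
      let e : π.asModule ≃ₗ[MonoidAlgebra ℂ G] M :=
        { π.asModuleEquiv with map_smul' := fun r m => hact r m }
      exact IsSimpleModule.congr e
    have : FiniteDimensional ℂ M := Module.Finite.trans (MonoidAlgebra ℂ G) _
    have h1 := sum_smul_eq_zero_of_isIrreducible π hπ hF (h0 _ (character_mem_Irr π hπ))
    have h2 : π.asAlgebraHom a = 0 := by
      rw [← h1]
      simp [a, asAlgebraHom_single]
    -- Acting on the class of `1` in the quotient by `I` turns annihilation into membership in `I`.
    have h3 := hact a (Submodule.Quotient.mk 1)
    rw [h2, LinearMap.zero_apply, ← Submodule.Quotient.mk_smul, smul_eq_mul, mul_one, eq_comm,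
      Submodule.Quotient.mk_eq_zero] at h3
    exact h3
  rw [IsSemisimpleRing.jacobson_eq_bot, Submodule.mem_bot] at ha
  funext g
  classical
  have := congrArg (fun b : MonoidAlgebra ℂ G => b.coeff g) ha
  simpa [a, MonoidAlgebra.coeff_sum, Finsupp.single_apply, Finsupp.finsetSum_apply] using this

end Orthogonality

theorem sum_dual_apply {Q : Type*} [Group Q] [Finite Q] [IsCyclic Q] [Fintype (Q →* ℂˣ)]
    [DecidableEq Q] (a : Q) :
    ∑ χ : Q →* ℂˣ, (χ a : ℂ) = if a = 1 then (Nat.card Q : ℂ) else 0 := by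
  let _ : CommGroup Q := IsCyclic.commGroup
  split_ifs with h
  · subst h
    simp [← CommGroup.card_monoidHom_of_hasEnoughRootsOfUnity Q ℂ]
  · obtain ⟨ψ, hψ⟩ := CommGroup.exists_apply_ne_one_of_hasEnoughRootsOfUnity Q ℂ h
    -- Translation by `ψ` permutes the summands, so the sum is fixed under multiplication by `ψ a ≠
    -- 1`.
    have key : (ψ a : ℂ) * ∑ χ : Q →* ℂˣ, (χ a : ℂ) = ∑ χ : Q →* ℂˣ, (χ a : ℂ) := by
      rw [Finset.mul_sum]
      exact Fintype.sum_equiv (Equiv.mulLeft ψ) _ _ fun χ => by simp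
    by_contra h0
    exact hψ (Units.ext (mul_right_cancel₀ h0 (key.trans (one_mul _).symm)))

theorem card_dual_eq_index {G : Type*} [Group G] [Finite G] (N : Subgroup G) [N.Normal]
    [IsCyclic (G ⧸ N)] : Nat.card (G ⧸ N →* ℂˣ) = N.index := by
  let _ : CommGroup (G ⧸ N) := IsCyclic.commGroup
  exact CommGroup.card_monoidHom_of_hasEnoughRootsOfUnity (G ⧸ N) ℂ

instance finite_dual {G : Type*} [Group G] [Finite G] (N : Subgroup G) [N.Normal]
    [IsCyclic (G ⧸ N)] : Finite (G ⧸ N →* ℂˣ) :=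
  Nat.finite_of_card_ne_zero (card_dual_eq_index N ▸ N.index_ne_zero_of_finite)

theorem linearIndependent_of_dual {ι K V : Type*} [Field K] [AddCommGroup V] [Module K V]
    (v : ι → V) (w : ι → V →ₗ[K] K) (h : ∀ i j, i ≠ j → w i (v j) = 0) (h' : ∀ i, w i (v i) ≠ 0) :
    LinearIndependent K v := by
  rw [linearIndependent_iff']
  intro s c hc i hi
  have := congrArg (w i) hc
  rw [map_sum, map_zero, Finset.sum_eq_single_of_mem i hi
    fun j _ hj => by rw [map_smul, h i j hj.symm, smul_zero], map_smul, smul_eq_mul] at this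
  exact (mul_eq_zero.mp this).resolve_right (h' i)

/-! ### Class functions, restriction and orbits -/

variable {G : Type*} [Group G]

theorem Irr_apply_conj {f : G → ℂ} (hf : f ∈ Irr G) (g h : G) : f (h * g * h⁻¹) = f g := by
  obtain ⟨V, _, _, _, π, hπ, rfl⟩ := hf
  exact π.char_conj g h

theorem finite_Irr [Finite G] : (Irr G).Finite := by
  classical
  have := Fintype.ofFinite G
  have hli : LinearIndependent ℂ (Subtype.val : Irr G → G → ℂ) := by
    refine linearIndependent_of_dual _
      (fun f => ∑ g, (f.1 g⁻¹) • LinearMap.proj (φ := fun _ : G => ℂ) g) (fun f h hfh => ?_)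
      fun f => ?_
    · simpa [mul_comm, Subtype.coe_inj, hfh.symm] using sum_mul_inv_eq_ite h.2 f.2
    · simpa [mul_comm] using (sum_mul_inv_eq_ite f.2 f.2).trans_ne (by simp)
  exact hli.setFinite

open scoped Classical in
/-- The extension by zero to `G` of a function on a set of conjugacy classes. -/
noncomputable def extendClasses (S : Set (ConjClasses G)) : (S → ℂ) →ₗ[ℂ] G → ℂ where
  toFun c g := if h : ConjClasses.mk g ∈ S then c ⟨_, h⟩ else 0
  map_add' c d := by
    funext g
    by_cases h : ConjClasses.mk g ∈ S <;> simp [h]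
  map_smul' a c := by
    funext g
    by_cases h : ConjClasses.mk g ∈ S <;> simp [h]

theorem extendClasses_conj (S : Set (ConjClasses G)) (c : S → ℂ) (g h : G) :
    extendClasses S c (h * g * h⁻¹) = extendClasses S c g := by
  have : ConjClasses.mk (h * g * h⁻¹) = ConjClasses.mk g :=
    ConjClasses.mk_eq_mk_iff_isConj.mpr (isConj_iff.mpr ⟨h, rfl⟩).symm
  classical
  change dite _ _ _ = dite _ _ _
  rw [this]

theorem extendClasses_injective (S : Set (ConjClasses G)) :
    Function.Injective (extendClasses S) := by
  intro c d h
  funext ⟨C, hC⟩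
  obtain ⟨g, rfl⟩ := ConjClasses.exists_rep C
  simpa [extendClasses, hC] using congrFun h g

theorem mem_smul_coe_iff (N : Subgroup G) (q g : G) : g ∈ q • (N : Set G) ↔ (g : G ⧸ N) = q := by
  rw [mem_leftCoset_iff, SetLike.mem_coe, ← QuotientGroup.eq, eq_comm]

/-- A `G`-stable subspace is `N`-stable. That the given representation is irreducible over `N` is
read off from the norm of its character. -/
theorem mem_Irr_of_Res_mem_Irr [Finite G] (N : Subgroup G) {f : G → ℂ} (hf : IsCharacter G f) (h : Res N f ∈ Irr N) :
    f ∈ Irr G := by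
  classical
  have := Fintype.ofFinite G
  have := Fintype.ofFinite N
  obtain ⟨V, _, _, _, π, rfl⟩ := hf
  have hN : (Representation.IsIrreducible (π.comp N.subtype : Representation ℂ N V)) :=
    isIrreducible_of_sum_mul_inv_eq_card _ ((sum_mul_inv_eq_ite h h).trans (if_pos rfl))
  let r : Subrepresentation π → Subrepresentation (π.comp N.subtype : Representation ℂ N V) :=
    fun W => ⟨W.toSubmodule, fun n v hv => W.apply_mem_toSubmodule n hv⟩
  refine ⟨V, inferInstance, inferInstance, inferInstance, π, ?_, rfl⟩
  refine { exists_pair_ne := ⟨⊥, ⊤, fun hbt => ?_⟩, eq_bot_or_eq_top := fun W => ?_ }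
  · have h1 : (r ⊥) = r ⊤ := by rw [hbt]
    exact bot_ne_top (α := Subrepresentation (π.comp N.subtype : Representation ℂ N V)) h1
  · exact (hN.eq_bot_or_eq_top (r W)).imp
      (fun h => Subrepresentation.toSubmodule_injective (congrArg (·.toSubmodule) h))
      (fun h => Subrepresentation.toSubmodule_injective (congrArg (·.toSubmodule) h))

variable (N : Subgroup G) [N.Normal]

theorem smul_Irr_apply (χ : G ⧸ N →* ℂˣ) (ρ : Irr G) (g : G) :
    (χ • ρ).1 g = (χ (g : G ⧸ N) : ℂ) * ρ.1 g := rfl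

theorem orbitOf_eq_iff (ρ ρ' : Irr G) :
    orbitOf N ρ = orbitOf N ρ' ↔ ∃ χ : G ⧸ N →* ℂˣ, χ • ρ = ρ' := by
  rw [eq_comm]
  exact Quotient.eq (r := MulAction.orbitRel (G ⧸ N →* ℂˣ) (Irr G))

theorem Res_smul (χ : G ⧸ N →* ℂˣ) (ρ : Irr G) : Res N (χ • ρ).1 = Res N ρ := by
  funext n
  simp [Res, smul_Irr_apply, (QuotientGroup.eq_one_iff (n : G)).mpr n.2]

theorem orbitOf_surjective : Function.Surjective (orbitOf N) := Quotient.mk_surjective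

/-- Restriction to `N`, as a function on the set of orbits. -/
def orbitRes : Orbits N → N → ℂ :=
  Quotient.lift (fun ρ : Irr G => Res N ρ) fun ρ ρ' h => by
    obtain ⟨χ, hχ⟩ := h
    rw [← hχ]
    exact Res_smul N χ ρ'

/-- Since `G ⧸ N` is abelian, conjugate elements lie in the same coset. -/
theorem mk_mem_classesIn_iff [IsCyclic (G ⧸ N)] (q g : G) :
    ConjClasses.mk g ∈ classesIn N q ↔ (g : G ⧸ N) = q := by
  let _ : CommGroup (G ⧸ N) := IsCyclic.commGroup
  constructor
  · intro h
    exact (mem_smul_coe_iff N q g).mp (h ConjClasses.mem_carrier_mk)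
  · intro h x hx
    rw [ConjClasses.mem_carrier_iff_mk_eq, ConjClasses.mk_eq_mk_iff_isConj] at hx
    rw [mem_smul_coe_iff, ← h]
    exact isConj_iff_eq.mp ((QuotientGroup.mk' N).map_isConj hx)

/-! ### Scalar products over a coset -/

section CosetSum

variable [Fintype G]

open scoped Classical in
/-- The unnormalised scalar product of the restrictions of `f` and `h` to a coset of `N`. -/
noncomputable def cosetSum (p : G ⧸ N) (f h : G → ℂ) : ℂ :=
  ∑ g : G, if (g : G ⧸ N) = p then f g * h g⁻¹ else 0

theorem cosetSum_one [Fintype N] (f h : G → ℂ) : cosetSum N 1 f h = ∑ n : N, Res N f n * Res N h n⁻¹ := by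
  classical
  simp only [cosetSum, QuotientGroup.eq_one_iff]
  rw [← Finset.sum_filter]
  exact Finset.sum_subtype _ (by simp) _

variable [IsCyclic (G ⧸ N)]

open scoped Classical in
-- Expand the indicator function of the coset in characters of `G ⧸ N`, exchange the sums, and apply
-- orthogonality on `G` to `χ • ρ` and `ρ'`.
theorem index_mul_cosetSum [Fintype (G ⧸ N →* ℂˣ)] (p : G ⧸ N) (ρ ρ' : Irr G) :
    (N.index : ℂ) * cosetSum N p ρ ρ' =
      ∑ χ : G ⧸ N →* ℂˣ, (χ p⁻¹ : ℂ) * if χ • ρ = ρ' then (Nat.card G : ℂ) else 0 := by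
  have h (χ : G ⧸ N →* ℂˣ) : (χ p⁻¹ : ℂ) * (if χ • ρ = ρ' then (Nat.card G : ℂ) else 0) =
      ∑ g : G, (χ (p⁻¹ * g) : ℂ) * (ρ.1 g * ρ'.1 g⁻¹) := by
    rw [← if_congr Subtype.coe_inj rfl rfl, ← sum_mul_inv_eq_ite (χ • ρ).2 ρ'.2, Finset.mul_sum]
    refine Finset.sum_congr rfl fun g _ => ?_
    rw [smul_Irr_apply, map_mul, Units.val_mul]
    ring
  simp_rw [h]
  rw [Finset.sum_comm, cosetSum, Finset.mul_sum]
  refine Finset.sum_congr rfl fun g _ => ?_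
  rw [← Finset.sum_mul, sum_dual_apply, ite_mul, mul_ite, mul_zero, zero_mul]
  simp only [inv_mul_eq_one, @eq_comm _ p]
  rfl

theorem cosetSum_eq_zero {p : G ⧸ N} {ρ ρ' : Irr G} (h : orbitOf N ρ ≠ orbitOf N ρ') :
    cosetSum N p ρ ρ' = 0 := by
  classical
  have := Fintype.ofFinite (G ⧸ N →* ℂˣ)
  have key := index_mul_cosetSum N p ρ ρ'
  rw [Finset.sum_eq_zero fun χ _ => by
    rw [if_neg fun hχ => h ((orbitOf_eq_iff N ρ ρ').mpr ⟨χ, hχ⟩), mul_zero]] at key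
  exact (mul_eq_zero.mp key).resolve_left (Nat.cast_ne_zero.mpr N.index_ne_zero_of_finite)

theorem cosetSum_self_ne_zero (p : G ⧸ N) {ρ : Irr G}
    (h : MulAction.stabilizer (G ⧸ N →* ℂˣ) ρ = ⊥) : cosetSum N p ρ ρ ≠ 0 := by
  classical
  have := Fintype.ofFinite (G ⧸ N →* ℂˣ)
  have key := index_mul_cosetSum N p ρ ρ
  -- Only `χ = 1` contributes, and its term is `|G|`.
  simp_rw [← MulAction.mem_stabilizer_iff, h, Subgroup.mem_bot] at key
  intro h0
  simp [h0, -Nat.card_eq_fintype_card, eq_comm (a := (0 : ℂ))] at key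
  exact Nat.card_pos.ne' key

theorem sum_Res_mul_Res_inv [Fintype N] (ρ ρ' : Irr G) :
    ∑ n : N, Res N ρ n * Res N ρ' n⁻¹ =
      (Nat.card N : ℂ) * Nat.card {χ : G ⧸ N →* ℂˣ // χ • ρ = ρ'} := by
  classical
  have := Fintype.ofFinite (G ⧸ N →* ℂˣ)
  have key := index_mul_cosetSum N 1 ρ ρ'
  have h0 : (N.index : ℂ) ≠ 0 := Nat.cast_ne_zero.mpr N.index_ne_zero_of_finite
  rw [cosetSum_one] at key
  apply mul_left_cancel₀ h0
  have hc : (Nat.card {χ : G ⧸ N →* ℂˣ // χ • ρ = ρ'} : ℂ) =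
      ∑ χ : G ⧸ N →* ℂˣ, if χ • ρ = ρ' then 1 else 0 := by
    rw [Nat.card_eq_fintype_card, Fintype.card_subtype]
    simp
  rw [key, hc, ← N.card_mul_index, Finset.mul_sum, Finset.mul_sum]
  refine Finset.sum_congr rfl fun χ _ => ?_
  rw [inv_one, map_one, Units.val_one, one_mul, mul_ite, mul_ite, mul_one, mul_zero, mul_zero,
    Nat.cast_mul, mul_comm]

end CosetSum

/-! ### Characters with trivial stabilizer -/

variable [Finite G] [IsCyclic (G ⧸ N)]

theorem Res_mem_Irr_iff (ρ : Irr G) :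
    Res N ρ ∈ Irr N ↔ MulAction.stabilizer (G ⧸ N →* ℂˣ) ρ = ⊥ := by
  classical
  have := Fintype.ofFinite G
  have := Fintype.ofFinite N
  have h0 : (Nat.card N : ℂ) ≠ 0 := Nat.cast_ne_zero.mpr Nat.card_pos.ne'
  have key : ∑ n : N, Res N ρ n * Res N ρ n⁻¹ =
    (Nat.card N : ℂ) * Nat.card (MulAction.stabilizer (G ⧸ N →* ℂˣ) ρ) := sum_Res_mul_Res_inv N ρ ρ
  constructor
  · intro h
    rw [sum_mul_inv_eq_ite h h, if_pos rfl, left_eq_mul₀ h0, Nat.cast_eq_one] at key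
    exact Subgroup.card_eq_one.mp key
  · intro h
    rw [Subgroup.card_eq_one.mpr h, Nat.cast_one, mul_one] at key
    obtain ⟨V, _, _, _, π, hπ, hρ⟩ := ρ.2
    refine ⟨V, inferInstance, inferInstance, inferInstance, π.comp N.subtype, ?_, ?_⟩
    · apply isIrreducible_of_sum_mul_inv_eq_card
      rw [← key, hρ]
      rfl
    · rw [hρ]
      rfl

/-- The scalar product of the restrictions counts the `χ` taking `ρ` to `ρ'`; here it is nonzero, so
such a `χ` exists. -/
theorem orbitOf_eq_of_Res_eq {ρ ρ' : Irr G} (hρ : Res N ρ ∈ Irr N) (h : Res N ρ = Res N ρ') :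
    orbitOf N ρ = orbitOf N ρ' := by
  classical
  have := Fintype.ofFinite G
  have := Fintype.ofFinite N
  have key := sum_Res_mul_Res_inv N ρ ρ'
  rw [← h, sum_mul_inv_eq_ite hρ hρ, if_pos rfl] at key
  rw [orbitOf_eq_iff]
  by_contra hne
  have : IsEmpty {χ : G ⧸ N →* ℂˣ // χ • ρ = ρ'} := ⟨fun χ => hne ⟨χ.1, χ.2⟩⟩
  simp at key

theorem orbitOf_mem_orbitsOfFullLength_iff (ρ : Irr G) :
    orbitOf N ρ ∈ orbitsOfFullLength N ↔ MulAction.stabilizer (G ⧸ N →* ℂˣ) ρ = ⊥ := by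
  change (MulAction.orbit (G ⧸ N →* ℂˣ) ρ).ncard = N.index ↔ _
  rw [← MulAction.index_stabilizer, ← card_dual_eq_index N, ← Subgroup.card_mul_index
    (MulAction.stabilizer (G ⧸ N →* ℂˣ) ρ), right_eq_mul₀ Subgroup.index_ne_zero_of_finite,
    Subgroup.card_eq_one]

/-- If `χ` fixes `ρ` and `ρ` is nonzero somewhere on `qN`, then `χ q = 1`, and `χ` is trivial
because `q` generates. Conversely, a trivial stabilizer makes the scalar product of `ρ` with itself
over `qN` nonzero. -/
theorem exists_apply_ne_zero_iff {q : G} (hq : Subgroup.zpowers (q : G ⧸ N) = ⊤) (ρ : Irr G) :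
    (∃ g ∈ q • (N : Set G), ρ.1 g ≠ 0) ↔ MulAction.stabilizer (G ⧸ N →* ℂˣ) ρ = ⊥ := by
  simp only [mem_smul_coe_iff]
  constructor
  · rintro ⟨g, hg, h0⟩
    rw [eq_bot_iff]
    intro χ hχ
    have h1 : (χ (g : G ⧸ N) : ℂ) * ρ.1 g = ρ.1 g := congrArg (fun f : Irr G => f.1 g) hχ
    have h2 : χ (q : G ⧸ N) = 1 := by
      rw [← hg]
      exact Units.ext (mul_right_cancel₀ h0 (h1.trans (one_mul _).symm))
    refine Subgroup.mem_bot.mpr (MonoidHom.ext fun x => ?_)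
    obtain ⟨k, rfl⟩ := Subgroup.mem_zpowers_iff.mp (hq ▸ Subgroup.mem_top x)
    simp [h2]
  · intro h
    have := Fintype.ofFinite G
    by_contra! h0
    refine cosetSum_self_ne_zero N (q : G ⧸ N) h (Finset.sum_eq_zero fun g _ => ?_)
    split_ifs with hg
    · rw [h0 g hg, zero_mul]
    · rfl

theorem orbitsNonzeroOn_eq_orbitsOfFullLength {q : G} (hq : Subgroup.zpowers (q : G ⧸ N) = ⊤) :
    orbitsNonzeroOn N q = orbitsOfFullLength N := by
  ext ω
  constructor
  · rintro ⟨ρ, rfl, h⟩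
    rwa [orbitOf_mem_orbitsOfFullLength_iff, ← exists_apply_ne_zero_iff N hq]
  · obtain ⟨ρ, rfl⟩ := orbitOf_surjective N ω
    intro h
    rw [orbitOf_mem_orbitsOfFullLength_iff, ← exists_apply_ne_zero_iff N hq] at h
    exact ⟨ρ, rfl, h⟩

/-! ### The counts -/

theorem ncard_orbitsOfFullLength_eq_ncard_extendable :
    (orbitsOfFullLength N).ncard =
      {τ ∈ Irr N | ∃ f : G → ℂ, IsCharacter G f ∧ Res N f = τ}.ncard := by
  have hinj : Set.InjOn (orbitRes N) (orbitsOfFullLength N) := by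
    intro ω hω ω' _ h
    obtain ⟨ρ, rfl⟩ := orbitOf_surjective N ω
    obtain ⟨ρ', rfl⟩ := orbitOf_surjective N ω'
    rw [orbitOf_mem_orbitsOfFullLength_iff, ← Res_mem_Irr_iff] at hω
    exact orbitOf_eq_of_Res_eq N hω h
  rw [← hinj.ncard_image]
  congr 1
  ext τ
  constructor
  · rintro ⟨ω, hω, rfl⟩
    obtain ⟨ρ, rfl⟩ := orbitOf_surjective N ω
    rw [orbitOf_mem_orbitsOfFullLength_iff, ← Res_mem_Irr_iff] at hω
    obtain ⟨V, _, _, _, π, hπ, hρ⟩ := ρ.2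
    exact ⟨hω, ρ.1, ⟨V, inferInstance, inferInstance, inferInstance, π, hρ⟩, rfl⟩
  · rintro ⟨hτ, f, hf, rfl⟩
    refine ⟨orbitOf N ⟨f, mem_Irr_of_Res_mem_Irr N hf hτ⟩, ?_, rfl⟩
    rwa [orbitOf_mem_orbitsOfFullLength_iff, ← Res_mem_Irr_iff]

theorem ncard_Res_mem_Irr :
    {ρ ∈ Irr G | Res N ρ ∈ Irr N}.ncard = (orbitsOfFullLength N).ncard * N.index := by
  classical
  have : Finite (Irr G) := finite_Irr
  have := Fintype.ofFinite (Irr G)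
  have := Fintype.ofFinite (Orbits N)
  have himage : {ρ ∈ Irr G | Res N ρ ∈ Irr N} =
      Subtype.val '' {ρ : Irr G | orbitOf N ρ ∈ orbitsOfFullLength N} := by
    ext f
    simp only [orbitOf_mem_orbitsOfFullLength_iff, ← Res_mem_Irr_iff]
    simp [and_comm]
  rw [himage, Set.ncard_image_of_injective _ Subtype.val_injective, Set.ncard_eq_toFinset_card',
    Set.ncard_eq_toFinset_card', Finset.card_eq_sum_card_fiberwise (f := orbitOf N)
      (t := (orbitsOfFullLength N).toFinset) (by intro ρ hρ; simpa using hρ),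
    ← smul_eq_mul, ← Finset.sum_const]
  refine Finset.sum_congr rfl fun ω hω => ?_
  have hω' : ω.orbit.ncard = N.index := (Set.mem_toFinset (s := orbitsOfFullLength N)).mp hω
  rw [← hω', Set.ncard_eq_toFinset_card']
  congr 1
  ext ρ
  have hρ : ρ ∈ ω.orbit ↔ orbitOf N ρ = ω := MulAction.orbitRel.Quotient.mem_orbit
  simp only [Finset.mem_filter, Set.mem_toFinset, Set.mem_ofPred_eq, hρ]
  exact ⟨fun h => h.2, fun h => ⟨h ▸ Set.mem_toFinset.mp hω, h⟩⟩

theorem ncard_classesIn {q : G} (hq : Subgroup.zpowers (q : G ⧸ N) = ⊤) :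
    (classesIn N q).ncard = (orbitsNonzeroOn N q).ncard := by
  classical
  have := Fintype.ofFinite G
  have : Finite (Irr G) := finite_Irr
  have := Fintype.ofFinite (classesIn N q)
  have := Fintype.ofFinite (orbitsNonzeroOn N q)
  let rep : orbitsNonzeroOn N q → Irr G := fun ω => Quotient.out ω.1
  have hrep (ω) : orbitOf N (rep ω) = ω.1 := Quotient.out_eq _
  have hext (c : classesIn N q → ℂ) {g : G} (hg : (g : G ⧸ N) ≠ q) :
      extendClasses _ c g = 0 := dif_neg (by rwa [mk_mem_classesIn_iff])
  rw [← Nat.card_coe_set_eq, ← Nat.card_coe_set_eq, Nat.card_eq_fintype_card,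
    Nat.card_eq_fintype_card]
  apply le_antisymm
  -- `L` pairs class functions supported on `qN` with orbit representatives; its injectivity bounds
  -- the number of classes by the number of orbits.
  · let L : (classesIn N q → ℂ) →ₗ[ℂ] (orbitsNonzeroOn N q → ℂ) :=
      LinearMap.pi fun ω =>
        (∑ g, ((rep ω).1 g) • LinearMap.proj (φ := fun _ : G => ℂ) g) ∘ₗ extendClasses _
    have hL (c ω) : L c ω = ∑ g, extendClasses _ c g * (rep ω).1 g := by simp [L, mul_comm]
    have hinj : Function.Injective L := by
      rw [← LinearMap.ker_eq_bot, LinearMap.ker_eq_bot']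
      intro c hc
      apply extendClasses_injective
      rw [map_zero]
      refine eq_zero_of_sum_mul_Irr_eq_zero (extendClasses_conj _ c) fun f hf => ?_
      by_cases hω : orbitOf N ⟨f, hf⟩ ∈ orbitsNonzeroOn N q
      -- On `qN` the character `f` differs from its representative only by the constant `χ q`. Off
      -- `qN` the class function vanishes.
      · obtain ⟨χ, hχ⟩ := (orbitOf_eq_iff N _ _).mp (hrep ⟨_, hω⟩)
        have h1 := (hL c ⟨_, hω⟩).symm.trans (congrFun hc _)
        rw [Pi.zero_apply] at h1
        rw [← mul_zero (χ (q : G ⧸ N) : ℂ), ← h1, Finset.mul_sum]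
        refine Finset.sum_congr rfl fun g _ => ?_
        by_cases hg : (g : G ⧸ N) = q
        · rw [show f g = _ from (congrArg (fun f : Irr G => f.1 g) hχ).symm, smul_Irr_apply, hg]
          ring
        · rw [hext c hg]
          ring
      · refine Finset.sum_eq_zero fun g _ => ?_
        by_cases hg : (g : G ⧸ N) = q
        · have : f g = 0 := by
            by_contra h0
            exact hω ⟨_, rfl, g, (mem_smul_coe_iff N q g).mpr hg, h0⟩
          rw [this, mul_zero]
        · rw [hext c hg, zero_mul]
    simpa using LinearMap.finrank_le_finrank_of_injective hinj
  -- Conversely, the restrictions to `qN`, viewed as functions on its classes, are independent: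
  -- pairing with `g ↦ rep ω g⁻¹` over the coset gives dual functionals up to nonzero scalars.
  · have hli : LinearIndependent ℂ (fun (ω : orbitsNonzeroOn N q) (C : classesIn N q) =>
        (rep ω).1 (ConjClasses.exists_rep C.1 |>.choose)) := by
      let w : orbitsNonzeroOn N q → (classesIn N q → ℂ) →ₗ[ℂ] ℂ := fun ω =>
        (∑ g, ((rep ω).1 g⁻¹) • LinearMap.proj (φ := fun _ : G => ℂ) g) ∘ₗ extendClasses _
      have hw (ω ω') : w ω (fun C => (rep ω').1 (ConjClasses.exists_rep C.1 |>.choose)) =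
          cosetSum N (q : G ⧸ N) (rep ω') (rep ω) := by
        simp only [w, cosetSum, LinearMap.comp_apply, LinearMap.sum_apply, LinearMap.smul_apply,
          LinearMap.proj_apply, smul_eq_mul]
        refine Finset.sum_congr rfl fun g _ => ?_
        split_ifs with hg
        · have hg' := (mk_mem_classesIn_iff N q g).mpr hg
          have hconj : IsConj (ConjClasses.exists_rep (ConjClasses.mk g)).choose g :=
            ConjClasses.mk_eq_mk_iff_isConj.mp (ConjClasses.exists_rep (ConjClasses.mk g)).choose_spec
          obtain ⟨x, hx⟩ := isConj_iff.mp hconj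
          rw [mul_comm]
          congr 1
          refine (dif_pos hg').trans ?_
          exact (Irr_apply_conj (rep ω').2 _ x).symm.trans (congrArg _ hx)
        · rw [hext _ hg, mul_zero]
      refine linearIndependent_of_dual _ w (fun ω ω' h => ?_) fun ω => ?_
      · rw [hw]
        apply cosetSum_eq_zero
        rw [hrep, hrep]
        exact fun h' => h (Subtype.ext h'.symm)
      · rw [hw]
        apply cosetSum_self_ne_zero
        rw [← orbitOf_mem_orbitsOfFullLength_iff, hrep, ← orbitsNonzeroOn_eq_orbitsOfFullLength N hq]
        exact ω.2
    simpa using hli.fintype_card_le_finrank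

end CosetChar

theorem corollary3 {G : Type*} [Group G] [Finite G] (N : Subgroup G) [N.Normal] (q : G)
    (hq : Subgroup.zpowers (q : G ⧸ N) = ⊤) :
    (CosetChar.classesIn N q).ncard = (CosetChar.orbitsNonzeroOn N q).ncard ∧
    (CosetChar.orbitsNonzeroOn N q).ncard = (CosetChar.orbitsOfFullLength N).ncard ∧
    ((CosetChar.orbitsOfFullLength N).ncard : ℚ) =
      1 / (N.index : ℚ) *
        ({ρ ∈ CosetChar.Irr G | CosetChar.Res N ρ ∈ CosetChar.Irr N}.ncard : ℚ) ∧
    1 / (N.index : ℚ) *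
        ({ρ ∈ CosetChar.Irr G | CosetChar.Res N ρ ∈ CosetChar.Irr N}.ncard : ℚ) =
      ({τ ∈ CosetChar.Irr N |
        ∃ f : G → ℂ, CosetChar.IsCharacter G f ∧ CosetChar.Res N f = τ}.ncard : ℚ) := by
  have : IsCyclic (G ⧸ N) := ⟨(q : G ⧸ N), fun x => by
    change x ∈ Subgroup.zpowers (q : G ⧸ N)
    exact hq ▸ Subgroup.mem_top x⟩
  have h0 : (N.index : ℚ) ≠ 0 := Nat.cast_ne_zero.mpr N.index_ne_zero_of_finite
  have h3 : ((CosetChar.orbitsOfFullLength N).ncard : ℚ) = 1 / (N.index : ℚ) *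
      ({ρ ∈ CosetChar.Irr G | CosetChar.Res N ρ ∈ CosetChar.Irr N}.ncard : ℚ) := by
    rw [CosetChar.ncard_Res_mem_Irr, Nat.cast_mul]
    field_simp
  refine ⟨CosetChar.ncard_classesIn N hq,
    congrArg Set.ncard (CosetChar.orbitsNonzeroOn_eq_orbitsOfFullLength N hq), h3, ?_⟩
  rw [← h3, CosetChar.ncard_orbitsOfFullLength_eq_ncard_extendable]
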